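/- All graphs are finite, simple and connected; the girth of a graph is the length of its shortest cycle, and its order is its number of vertices. For integers $r<s$ and $g\ge 3$, an $(r,s;g)$-balanced biregular graph (babi-graph) is a graph of girth $g$ whose set of vertex degrees is $\{r,s\}$ and which has as many vertices of degree $r$ as of degree $s$. Let $n_{bb}(r,s;g)$ denote the minimum order of an $(r,s;g)$-babi-graph. **Theorem.** Let $2\le r<s$ and $g\ge 3$ be integers. Then an $(r,s;g)$-babi-graph exists, and $$n_{bb}(r,s;g)\le 32\left(\sum_{t=1}^{g-2}(r-1)^t\right)\left(\sum_{t=1}^{g-2}(s-1)^t\right).$$ -/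

import Mathlib

open Classical in
/-- A finite simple connected graph `G` is an `(r, s; g)`-balanced biregular graph (babi-graph):
its girth (the length of a shortest cycle) is `g`, the set of its vertex degrees is `{r, s}`,
and it has as many vertices of degree `r` as of degree `s`. -/
structure IsBabiGraph {V : Type*} [Fintype V] (G : SimpleGraph V) (r s g : ℕ) : Prop where
  connected : G.Connected
  egirth_eq : G.egirth = (g : ℕ∞)
  degreeSet_eq : Set.range (fun v : V => G.degree v) = {r, s}
  balanced : Fintype.card {v : V // G.degree v = r} = Fintype.card {v : V // G.degree v = s}

/-- The set of orders of `(r, s; g)`-babi-graphs. Every finite graph is isomorphic to one on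
some `Fin n`. -/
def babiOrders (r s g : ℕ) : Set ℕ :=
  {n | ∃ G : SimpleGraph (Fin n), IsBabiGraph G r s g}

/-- The order of an `(r, s; g)`-babi-cage, that is, the least order of an `(r, s; g)`-babi-graph
(meaningful when one exists). -/
noncomputable def nbb (r s g : ℕ) : ℕ := sInf (babiOrders r s g)

/-! Start from a `g`-cycle with a path attached, on `2m` vertices with `m = 16B`, `B` being the sum
over `s - 1`. Aim for degree `s` on the first `m` vertices and `r` on the rest. Among connected
graphs containing the cycle, of girth at least `g` and with degrees within the targets, maximise the
degree sum (`exists_degree_eq`). If some degree falls short, parity gives deficient `x`, `y`,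
possibly equal. The balls of radius `g - 2` around them and the cycle form a small set `S`. Every
vertex outside `S` is saturated, otherwise it could be joined to `x`, so by double counting some
edge `uv` avoids `S`. Replacing `uv` by `xu, yv` or by `xv, yu` preserves every constraint for one
of the two choices and raises the degree sum, a contradiction. The order is `32B`; the factor over
`r - 1` enters only through being at least 1. -/

namespace SimpleGraph

/-! ### Girth under edge additions, and edge switching. -/

variable {V : Type*}

/-- Every walk joining the endpoints of an edge of `G` without using that edge closes up to a
closed walk of length at least `g`. This says that the girth of `G` is at least `g`. -/
def GirthAtLeast (G : SimpleGraph V) (g : ℕ) : Prop :=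
  ∀ ⦃a b : V⦄, G.Adj a b → ∀ p : (G \ edge a b).Walk a b, g ≤ p.length + 1

/-- A walk in `H` with the edge `ab` added either shortcuts to a walk in `H`, or decomposes into
an initial and a final segment in `H` with endpoints among `a` and `b`. -/
lemma Walk.exists_walk_of_sup_edge {H : SimpleGraph V} {a b c d : V}
    (p : (H ⊔ edge a b).Walk c d) :
    (∃ q : H.Walk c d, q.length ≤ p.length) ∨
      ∃ w₁ w₂ : V, (w₁ = a ∨ w₁ = b) ∧ (w₂ = a ∨ w₂ = b) ∧
        ∃ (q₁ : H.Walk c w₁) (q₂ : H.Walk w₂ d), q₁.length + q₂.length + 1 ≤ p.length := by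
  induction p with
  | nil => exact .inl ⟨.nil, le_rfl⟩
  | @cons c z d h p ih =>
    rw [sup_adj] at h
    rcases h with h | h
    · rcases ih with ⟨q, hq⟩ | ⟨w₁, w₂, h₁, h₂, q₁, q₂, hq⟩
      · exact .inl ⟨.cons h q, by simpa using hq⟩
      · exact .inr ⟨w₁, w₂, h₁, h₂, .cons h q₁, q₂, by simp only [Walk.length_cons]; omega⟩
    · rw [edge_adj] at h
      right
      rcases ih with ⟨q, hq⟩ | ⟨w₁, w₂, h₁, h₂, q₁, q₂, hq⟩
      · exact ⟨c, z, by tauto, by tauto, .nil, q, by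
          simp only [Walk.length_cons, Walk.length_nil]; omega⟩
      · exact ⟨c, w₂, by tauto, h₂, .nil, q₂, by
          simp only [Walk.length_cons, Walk.length_nil]; omega⟩

lemma GirthAtLeast.anti {G H : SimpleGraph V} {g : ℕ} (hG : G.GirthAtLeast g) (h : H ≤ G) :
    H.GirthAtLeast g := fun _ _ hab p => by
  simpa using hG (h hab) (p.mapLe (sdiff_le_sdiff_right h))

/-- Adding an edge between vertices at distance at least `g - 1` keeps the girth at least `g`. -/
lemma GirthAtLeast.sup_edge {H : SimpleGraph V} {g : ℕ} (hH : H.GirthAtLeast g) {a b : V}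
    (hab : ∀ p : H.Walk a b, g ≤ p.length + 1) : (H ⊔ edge a b).GirthAtLeast g := by
  intro c d hcd p
  by_cases he : s(a, b) = s(c, d)
  · have hle : (H ⊔ edge a b) \ edge c d ≤ H := by
      intro x y hxy
      rw [sdiff_adj, sup_adj, adj_edge, adj_edge, he] at hxy
      tauto
    rw [Sym2.eq_iff] at he
    rcases he with ⟨rfl, rfl⟩ | ⟨rfl, rfl⟩
    · simpa using hab (p.mapLe hle)
    · simpa using hab (p.mapLe hle).reverse
  · have hH' : H.Adj c d := by
      rw [sup_adj, adj_edge] at hcd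
      tauto
    have hle : (H ⊔ edge a b) \ edge c d ≤ (H \ edge c d) ⊔ edge a b := by
      intro x y hxy
      simp only [sdiff_adj, sup_adj] at hxy ⊢
      tauto
    have hle' : H \ edge c d ≤ H := sdiff_le
    rcases (p.mapLe hle).exists_walk_of_sup_edge with ⟨q, hq⟩ | ⟨w₁, w₂, h₁, h₂, q₁, q₂, hq⟩
    · have := hH hH' q
      simp only [Walk.length_map] at hq
      omega
    · simp only [Walk.length_map] at hq
      -- If both segments meet the new edge at the same endpoint, they join into a walk from `c` to
      -- `d` avoiding `cd`; otherwise, together with `cd`, they join `a` to `b` in `H`.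
      rcases h₁ with rfl | rfl <;> rcases h₂ with rfl | rfl
      · have := hH hH' (q₁.append q₂)
        simp only [Walk.length_append] at this
        omega
      · have := hab ((q₁.reverse.mapLe hle').append (.cons hH' (q₂.reverse.mapLe hle')))
        simp only [Walk.length_append, Walk.length_map, Walk.length_cons,
          Walk.length_reverse] at this
        omega
      · have := hab ((q₂.mapLe hle').append (.cons hH'.symm (q₁.mapLe hle')))
        simp only [Walk.length_append, Walk.length_map, Walk.length_cons] at this
        omega
      · have := hH hH' (q₁.append q₂)
        simp only [Walk.length_append] at this
        omega

lemma GirthAtLeast.le_egirth {G : SimpleGraph V} {g : ℕ} (hG : G.GirthAtLeast g) :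
    (g : ℕ∞) ≤ G.egirth := by
  rw [SimpleGraph.le_egirth]
  intro a w hw
  cases w with
  | nil => simp at hw
  | @cons _ b _ h p =>
    rw [Walk.cons_isCycle_iff] at hw
    have := hG h (p.transfer (G \ edge a b) (by
      intro e he
      have hne : e ≠ s(a, b) := by rintro rfl; exact hw.2 he
      have heG := p.edges_subset_edgeSet he
      induction e with
      | h x y =>
        rw [mem_edgeSet] at heG ⊢
        rw [sdiff_adj, adj_edge]
        exact ⟨heG, fun h' => hne h'.1.symm⟩)).reverse
    simp only [Walk.length_reverse, Walk.length_transfer] at this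
    simpa using mod_cast this

lemma egirth_le_of_not_girthAtLeast {G : SimpleGraph V} {g : ℕ}
    (hG : ¬ G.GirthAtLeast (g + 1)) : G.egirth ≤ g := by
  classical
  simp only [GirthAtLeast, not_forall, not_le] at hG
  obtain ⟨a, b, hab, p, hp⟩ := hG
  have hle : G \ edge a b ≤ G := sdiff_le
  have hc : (Walk.cons hab.symm (p.bypass.mapLe hle)).IsCycle := by
    rw [Walk.cons_isCycle_iff]
    refine ⟨(Walk.isPath_mapLe hle).2 p.bypass_isPath, fun h => ?_⟩
    rw [Walk.edges_mapLe_eq_edges] at h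
    have := p.bypass.edges_subset_edgeSet h
    rw [mem_edgeSet, sdiff_adj, adj_edge] at this
    exact this.2 ⟨Sym2.eq_swap, hab.ne.symm⟩
  refine (egirth_le_length hc).trans ?_
  have := p.length_bypass_le_length
  simp only [Walk.length_cons, Walk.length_map]
  exact_mod_cast (by omega : p.bypass.length + 1 ≤ g)

/-- A graph is connected if it joins the endpoints of every edge of a connected graph. -/
lemma Connected.of_reachable {G H : SimpleGraph V} (hG : G.Connected)
    (h : ∀ a b, G.Adj a b → H.Reachable a b) : H.Connected := by
  have := hG.nonempty
  refine ⟨fun a b => ?_⟩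
  obtain ⟨p⟩ := hG a b
  induction p with
  | nil => rfl
  | cons hadj _ ih => exact (h _ _ hadj).trans ih

lemma Connected.sdiff_edge_sup {G H : SimpleGraph V} (hG : G.Connected) {u v : V}
    (hle : G \ edge u v ≤ H) (huv : H.Reachable u v) : H.Connected := by
  refine hG.of_reachable fun a b hab => ?_
  by_cases h : (edge u v).Adj a b
  · rw [edge_adj] at h
    rcases h.1 with ⟨rfl, rfl⟩ | ⟨rfl, rfl⟩
    exacts [huv, huv.symm]
  · exact (hle ⟨hab, h⟩ : H.Adj a b).reachable

lemma Connected.reachable_sdiff_edge {G : SimpleGraph V} (hG : G.Connected) (u v x : V) :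
    (G \ edge u v).Reachable x u ∨ (G \ edge u v).Reachable x v := by
  obtain ⟨p⟩ := hG x u
  have hle : G ≤ (G \ edge u v) ⊔ edge u v := by rw [sdiff_sup_self]; exact le_sup_left
  rcases (p.mapLe hle).exists_walk_of_sup_edge with ⟨q, -⟩ | ⟨w, -, rfl | rfl, -, q, -, -⟩
  exacts [.inl ⟨q⟩, .inl ⟨q⟩, .inr ⟨q⟩]

/-- Replacing an edge `uv` of a connected graph by edges `xu` and `yv`, or by `xv` and `yu`,
one of the two results is connected. -/
lemma Connected.exists_switch {G : SimpleGraph V} (hG : G.Connected) {u v x y : V}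
    (hxu : x ≠ u) (hxv : x ≠ v) (hyv : y ≠ v) :
    (G \ edge u v ⊔ edge x u ⊔ edge y v).Connected ∨
      (G \ edge u v ⊔ edge x v ⊔ edge y u).Connected := by
  have key : ∀ {w z : V} (H : SimpleGraph V), (edge w z).Adj w z → edge w z ≤ H →
      H.Reachable w z := fun H h hle => (hle h).reachable
  have hadj : ∀ {w z : V}, w ≠ z → (edge w z).Adj w z := fun h => by simp [edge_adj, h]
  have hle : ∀ E F : SimpleGraph V, G \ edge u v ≤ G \ edge u v ⊔ E ⊔ F :=
    fun E F => le_sup_left.trans le_sup_left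
  have h₁ : ∀ E F : SimpleGraph V, E ≤ G \ edge u v ⊔ E ⊔ F :=
    fun E F => le_sup_right.trans le_sup_left
  by_cases hx : (G \ edge u v).Reachable x v
  · left
    exact hG.sdiff_edge_sup (hle _ _)
      ((key _ (hadj hxu) (h₁ _ _)).symm.trans (hx.mono (hle _ _)))
  by_cases hy : (G \ edge u v).Reachable y u
  · left
    exact hG.sdiff_edge_sup (hle _ _)
      ((hy.mono (hle _ _)).symm.trans (key _ (hadj hyv) le_sup_right))
  · right
    have hx' := (hG.reachable_sdiff_edge u v x).resolve_right hx
    exact hG.sdiff_edge_sup (hle _ _)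
      ((hx'.mono (hle _ _)).symm.trans (key _ (hadj hxv) (h₁ _ _)))

/-- Switching an edge `uv` for `xu` and `yv` keeps the girth at least `g` when `u` and `v` are far
from `x` and `y`. -/
lemma GirthAtLeast.switch {G : SimpleGraph V} {g : ℕ} (hG : G.GirthAtLeast g) {u v x y : V}
    (huv : G.Adj u v) (hxu : ∀ p : G.Walk x u, g ≤ p.length + 1)
    (hxv : ∀ p : G.Walk x v, g ≤ p.length + 1) (hyv : ∀ p : G.Walk y v, g ≤ p.length + 1) :
    (G \ edge u v ⊔ edge x u ⊔ edge y v).GirthAtLeast g := by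
  have hle : G \ edge u v ≤ G := sdiff_le
  refine ((hG.anti hle).sup_edge fun p => by simpa using hxu (p.mapLe hle)).sup_edge fun p => ?_
  rcases p.exists_walk_of_sup_edge with ⟨q, hq⟩ | ⟨w₁, w₂, -, rfl | rfl, q₁, q₂, hq⟩
  · have := hyv (q.mapLe hle)
    simp only [Walk.length_map] at this
    omega
  · have := hxv (q₂.mapLe hle)
    simp only [Walk.length_map] at this
    omega
  -- A final segment from `u` to `v` avoids `uv`, so the girth of `G` already bounds it; no distance
  -- from `y` to `u` is needed.
  · have := hG huv q₂
    omega


/-! ### Degree counts, Moore bound and the extremal argument. -/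

section Degree

variable {V : Type*} [Fintype V]

lemma degree_of_eq_sup_edge [DecidableEq V] {G H : SimpleGraph V} [DecidableRel G.Adj]
    [DecidableRel H.Adj] {a b : V} (hH : H = G ⊔ edge a b) (hab : a ≠ b) (h : ¬ G.Adj a b)
    (v : V) :
    H.degree v = G.degree v + (if v = a then 1 else 0) + (if v = b then 1 else 0) := by
  have key : ∀ {c d : V}, H = G ⊔ edge c d → c ≠ d → ¬ G.Adj c d →
      H.degree c = G.degree c + 1 := by
    intro c d hH hcd h
    rw [← card_neighborFinset_eq_degree, ← card_neighborFinset_eq_degree,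
      ← Finset.card_insert_of_notMem (a := d) (s := G.neighborFinset c) (by simpa using h)]
    congr 1
    ext w
    simp only [mem_neighborFinset, hH, sup_adj, edge_adj, Finset.mem_insert]
    grind
  by_cases ha : v = a
  · subst ha
    rw [key hH hab h]
    simp [hab]
  by_cases hb : v = b
  · subst hb
    rw [edge_comm] at hH
    rw [key hH hab.symm (fun h' => h h'.symm)]
    simp [hab.symm]
  · simp only [ha, hb, if_false, add_zero]
    rw [← card_neighborFinset_eq_degree, ← card_neighborFinset_eq_degree]
    congr 1
    ext w
    simp only [mem_neighborFinset, hH, sup_adj, edge_adj]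
    grind

/-- `u` and `v` each lose one neighbour and regain one. The case `x = y` is allowed, and then `x`
gains two. -/
lemma degree_switch [DecidableEq V] (G H : SimpleGraph V) [DecidableRel G.Adj]
    [DecidableRel H.Adj] {u v x y : V} (hH : H = G \ edge u v ⊔ edge x u ⊔ edge y v)
    (huv : G.Adj u v) (hxu : x ≠ u)
    (hxv : x ≠ v) (hyv : y ≠ v) (hxu' : ¬ G.Adj x u) (hyv' : ¬ G.Adj y v) (w : V) :
    H.degree w = G.degree w + (if w = x then 1 else 0) + (if w = y then 1 else 0) := by
  have hG : G = G \ edge u v ⊔ edge u v := by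
    rw [sdiff_sup_self]
    exact (sup_edge_of_adj G huv).symm
  have h₀ : ¬ (G \ edge u v).Adj u v := by simp [edge_adj, huv.ne]
  have h₁ : ¬ (G \ edge u v).Adj x u := fun h => hxu' h.1
  have h₂ : ¬ (G \ edge u v ⊔ edge x u).Adj y v := by
    rw [sup_adj, edge_adj]
    rintro (h | ⟨⟨-, h⟩ | ⟨-, h⟩, -⟩)
    exacts [hyv' h.1, huv.ne h.symm, hxv h.symm]
  rw [degree_of_eq_sup_edge hH hyv h₂, degree_of_eq_sup_edge rfl hxu h₁,
    degree_of_eq_sup_edge hG huv.ne h₀]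
  omega

-- A vertex other than `x` spends one neighbour on its predecessor, and `x` is deficient, so spheres
-- grow by a factor of at most `s - 1` from the first step on.
open Classical in
lemma Connected.card_dist_eq_le {G : SimpleGraph V} (hG : G.Connected) {s : ℕ}
    (hd : ∀ v, G.degree v ≤ s) {x : V} (hx : G.degree x < s) (k : ℕ) :
    (Finset.univ.filter fun v => G.dist x v = k).card ≤ (s - 1) ^ k := by
  have step : ∀ k v, G.dist x v = k + 1 → ∃ z, G.dist x z = k ∧ G.Adj z v := by
    intro k v hv
    obtain ⟨p, hp⟩ := hG.exists_walk_length_eq_dist v x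
    cases p with
    | nil => simp at hv
    | @cons _ z _ h p =>
      refine ⟨z, ?_, h.symm⟩
      have h₁ := G.dist_le p
      have h₂ := hG.dist_triangle (u := x) (v := z) (w := v)
      rw [dist_eq_one_iff_adj.2 h.symm] at h₂
      rw [dist_comm (u := z)] at h₁
      rw [dist_comm (u := v), Walk.length_cons] at hp
      omega
  induction k with
  | zero =>
    rw [pow_zero, Finset.card_le_one]
    simp only [Finset.mem_filter, Finset.mem_univ, true_and, hG.dist_eq_zero_iff]
    rintro a rfl b rfl
    rfl
  | succ k ih =>
    have hsub : (Finset.univ.filter fun v => G.dist x v = k + 1) ⊆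
        (Finset.univ.filter fun v => G.dist x v = k).biUnion
          fun z => (G.neighborFinset z).filter fun v => G.dist x v = k + 1 := by
      intro v hv
      simp only [Finset.mem_filter, Finset.mem_univ, true_and, Finset.mem_biUnion,
        mem_neighborFinset] at hv ⊢
      obtain ⟨z, hz, hzv⟩ := step k v hv
      exact ⟨z, hz, hzv, hv⟩
    refine (Finset.card_le_card hsub).trans ((Finset.card_biUnion_le_card_mul _ _ (s - 1) ?_).trans
      (by rw [pow_succ]; exact Nat.mul_le_mul_right _ ih))
    intro z hz
    rw [Finset.mem_filter] at hz
    rcases k with _ | k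
    · have hxz : x = z := hG.dist_eq_zero_iff.1 hz.2
      have := Finset.card_filter_le (G.neighborFinset z) fun v => G.dist x v = 0 + 1
      rw [card_neighborFinset_eq_degree, ← hxz] at this
      rw [← hxz]
      omega
    · obtain ⟨w, hw, hwz⟩ := step k z hz.2
      have hlt : ((G.neighborFinset z).filter fun v => G.dist x v = k + 1 + 1).card <
          (G.neighborFinset z).card := by
        refine Finset.card_lt_card (Finset.filter_ssubset.2 ⟨w, ?_, by omega⟩)
        simpa using hwz.symm
      rw [card_neighborFinset_eq_degree] at hlt
      have := hd z
      omega

open Classical in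
/-- Moore-type bound on the size of a ball around a vertex of deficient degree. -/
lemma Connected.card_dist_lt_le {G : SimpleGraph V} (hG : G.Connected) {s : ℕ}
    (hd : ∀ v, G.degree v ≤ s) {x : V} (hx : G.degree x < s) (k : ℕ) :
    (Finset.univ.filter fun v => G.dist x v < k).card ≤ ∑ t ∈ Finset.range k, (s - 1) ^ t := by
  have hsub : (Finset.univ.filter fun v => G.dist x v < k) ⊆
      (Finset.range k).biUnion fun t => Finset.univ.filter fun v => G.dist x v = t := by
    intro v
    simp
  exact (Finset.card_le_card hsub).trans
    (Finset.card_biUnion_le.trans (Finset.sum_le_sum fun t _ => hG.card_dist_eq_le hd hx t))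

open Classical in
/-- If more than twice as many vertices as there are in `S` have maximal degree as soon as they lie
outside `S`, then some edge avoids `S`. -/
lemma exists_adj_notMem (G : SimpleGraph V) {s : ℕ} (hs : 0 < s) (hd : ∀ v, G.degree v ≤ s)
    {S T : Finset V} (hT : ∀ v ∈ T, v ∉ S → G.degree v = s) (hST : 2 * S.card < T.card) :
    ∃ u v, u ∉ S ∧ v ∉ S ∧ G.Adj u v := by
  by_contra! hcon
  -- Were every edge to meet `S`, each vertex of `T \ S` would send `s` edges into `S`, which
  -- receives at most `s` per vertex.
  have h := Finset.card_mul_le_card_mul (s := T \ S) (t := S) G.Adj (m := s) (n := s)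
    (fun u hu => by
      rw [Finset.mem_sdiff] at hu
      rw [← hT u hu.1 hu.2, ← card_neighborFinset_eq_degree]
      refine Finset.card_le_card fun v hv => ?_
      rw [mem_neighborFinset] at hv
      rw [Finset.mem_bipartiteAbove]
      exact ⟨by_contra fun hvS => hcon u v hu.2 hvS hv, hv⟩)
    (fun v _ => by
      refine le_trans (Finset.card_le_card fun u hu => ?_)
        ((card_neighborFinset_eq_degree G v).le.trans (hd v))
      rw [Finset.mem_bipartiteBelow] at hu
      simpa using hu.2.symm)
  have h' := Nat.le_of_mul_le_mul_right h hs
  have := Finset.le_card_sdiff S T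
  omega

open Classical in
/-- If the degrees of `G` are bounded by `d`, with even total, and not all attained, then two
vertices are deficient, or one vertex is deficient twice. -/
lemma exists_deficient_pair (G : SimpleGraph V) {d : V → ℕ} (hd : ∀ v, G.degree v ≤ d v)
    (heven : Even (∑ v, d v)) (hne : ∃ x, G.degree x ≠ d x) :
    ∃ x y, G.degree x < d x ∧ G.degree y < d y ∧ (x = y → G.degree x + 2 ≤ d x) := by
  obtain ⟨x, hx⟩ := hne
  have hx' := lt_of_le_of_ne (hd x) hx
  by_cases h : ∃ y, y ≠ x ∧ G.degree y < d y
  · obtain ⟨y, hyx, hy⟩ := h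
    exact ⟨x, y, hx', hy, fun h => absurd h.symm hyx⟩
  · push Not at h
    refine ⟨x, x, hx', hx', fun _ => ?_⟩
    have h₁ := Finset.add_sum_erase Finset.univ d (Finset.mem_univ x)
    have h₂ := Finset.add_sum_erase Finset.univ (fun v => G.degree v) (Finset.mem_univ x)
    have h₃ : ∑ v ∈ Finset.univ.erase x, G.degree v = ∑ v ∈ Finset.univ.erase x, d v :=
      Finset.sum_congr rfl fun v hv => le_antisymm (hd v) (h v (Finset.ne_of_mem_erase hv))
    have h₄ := G.sum_degrees_eq_twice_card_edges
    obtain ⟨m, hm⟩ := heven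
    omega

open Classical in
/-- A connected graph of girth at least `g` on sufficiently many vertices, with degrees bounded
by `d`, can be transformed into one with degrees exactly `d` without touching a small subgraph. -/
theorem exists_degree_eq {s g : ℕ} (hs : 0 < s) (hg : 3 ≤ g) {d : V → ℕ} (hds : ∀ v, d v ≤ s)
    (heven : Even (∑ v, d v)) {C G₀ : SimpleGraph V} (hC : C ≤ G₀) (hconn : G₀.Connected)
    (hgirth : G₀.GirthAtLeast g) (hdeg : ∀ v, G₀.degree v ≤ d v) {K T : Finset V}
    (hK : ∀ a b, C.Adj a b → a ∈ K) (hT : ∀ v ∈ T, d v = s)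
    (hcard : 2 * (2 * ∑ t ∈ Finset.range (g - 1), (s - 1) ^ t + K.card) < T.card) :
    ∃ G : SimpleGraph V, C ≤ G ∧ G.Connected ∧ G.GirthAtLeast g ∧ ∀ v, G.degree v = d v := by
  obtain ⟨G, ⟨hCG, hGc, hGg, hGd⟩, hmax⟩ := Set.Finite.exists_maximalFor
    (fun G : SimpleGraph V => ∑ v, G.degree v)
    {G | C ≤ G ∧ G.Connected ∧ G.GirthAtLeast g ∧ ∀ v, G.degree v ≤ d v} (Set.toFinite _)
    ⟨G₀, hC, hconn, hgirth, hdeg⟩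
  refine ⟨G, hCG, hGc, hGg, ?_⟩
  by_contra! hne
  obtain ⟨x, y, hx, hy, hxy⟩ := G.exists_deficient_pair hGd heven hne
  have no_gain : ∀ (H : SimpleGraph V) (a b : V), C ≤ H → H.Connected → H.GirthAtLeast g →
      (∀ v, H.degree v = G.degree v + (if v = a then 1 else 0) + (if v = b then 1 else 0)) →
      G.degree a < d a → G.degree b < d b → (a = b → G.degree a + 2 ≤ d a) → False := by
    intro H a b hCH hHc hHg hHd ha hb hab
    have hle : ∀ v, H.degree v ≤ d v := by
      intro v
      have := hGd v
      rw [hHd]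
      grind
    have h₁ : ∑ v, G.degree v < ∑ v, H.degree v := by
      refine Finset.sum_lt_sum (fun v _ => ?_) ⟨a, Finset.mem_univ _, ?_⟩
      · rw [hHd]; omega
      · rw [hHd, if_pos rfl]; omega
    exact absurd (hmax ⟨hCH, hHc, hHg, hle⟩ h₁.le) (not_le.2 h₁)
  have hGs : ∀ v, G.degree v ≤ s := fun v => (hGd v).trans (hds v)
  set S : Finset V := (Finset.univ.filter fun v => G.dist x v < g - 1) ∪
    (Finset.univ.filter fun v => G.dist y v < g - 1) ∪ K with hS
  have hScard : S.card ≤ 2 * ∑ t ∈ Finset.range (g - 1), (s - 1) ^ t + K.card := by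
    have h₁ := hGc.card_dist_lt_le hGs (hx.trans_le (hds x)) (g - 1)
    have h₂ := hGc.card_dist_lt_le hGs (hy.trans_le (hds y)) (g - 1)
    refine (Finset.card_union_le _ _).trans (Nat.add_le_add_right ?_ _)
    refine (Finset.card_union_le _ _).trans ?_
    omega
  have hmem : ∀ u, u ∉ S → g - 1 ≤ G.dist x u ∧ g - 1 ≤ G.dist y u ∧ u ∉ K := by
    intro u hu
    simpa [hS, and_assoc] using hu
  have hfar : ∀ {z u}, g - 1 ≤ G.dist z u →
      z ≠ u ∧ ¬ G.Adj z u ∧ ∀ p : G.Walk z u, g ≤ p.length + 1 := by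
    intro z u h
    refine ⟨?_, fun hadj => ?_, fun p => ?_⟩
    · rintro rfl
      rw [dist_self] at h
      omega
    · rw [dist_eq_one_iff_adj.2 hadj] at h
      omega
    · have := G.dist_le p
      omega
  have hsat : ∀ u, u ∉ S → G.degree u = d u := by
    intro u hu
    by_contra hud
    obtain ⟨hne, hnadj, hw⟩ := hfar (hmem u hu).1
    exact no_gain (G ⊔ edge x u) x u (hCG.trans le_sup_left) (hGc.mono le_sup_left)
      (hGg.sup_edge hw) (fun w => by convert! degree_of_eq_sup_edge rfl hne hnadj w) hx (lt_of_le_of_ne (hGd u) hud)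
      fun h => absurd h hne
  have hswitch : ∀ u v, u ∉ S → v ∉ S → G.Adj u v →
      ¬ (G \ edge u v ⊔ edge x u ⊔ edge y v).Connected := by
    intro u v hu hv huv hc
    obtain ⟨hxu, -, huK⟩ := hmem u hu
    obtain ⟨hxv, hyv, hvK⟩ := hmem v hv
    obtain ⟨hxu₁, hxu₂, hxu₃⟩ := hfar hxu
    obtain ⟨hxv₁, -, hxv₃⟩ := hfar hxv
    obtain ⟨hyv₁, hyv₂, hyv₃⟩ := hfar hyv
    refine no_gain _ x y ?_ hc (hGg.switch huv hxu₃ hxv₃ hyv₃)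
      (fun w => by
        convert! G.degree_switch _ rfl huv hxu₁ hxv₁ hyv₁ hxu₂ hyv₂ w) hx hy hxy
    have : C ≤ G \ edge u v := by
      intro a b hab
      refine ⟨hCG hab, fun h => ?_⟩
      rw [edge_adj] at h
      rcases h.1 with ⟨rfl, -⟩ | ⟨rfl, -⟩
      exacts [huK (hK _ _ hab), hvK (hK _ _ hab)]
    exact this.trans (le_sup_left.trans le_sup_left)
  obtain ⟨u, v, hu, hv, huv⟩ := G.exists_adj_notMem hs hGs (S := S) (T := T)
    (fun v hv hvS => (hsat v hvS).trans (hT v hv)) (by omega)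
  rcases hGc.exists_switch (u := u) (v := v) (hfar (hmem u hu).1).1 (hfar (hmem v hv).1).1
    (hfar (hmem v hv).2.1).1 with h | h
  -- The other switch is the same one with `u` and `v` exchanged.
  · exact hswitch u v hu hv huv h
  · rw [edge_comm u v] at h
    exact hswitch v u hv hu huv.symm h

end Degree

/-! ### The starting graph. -/

section Lollipop

/-- Along a walk in a path graph, the position changes by at most the length of the walk. -/
lemma pathGraph_walk_le {n : ℕ} {a b : Fin n} (p : (pathGraph n).Walk a b) :
    b.val ≤ a.val + p.length := by
  induction p with
  | nil => simp
  | cons h p ih =>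
    rw [pathGraph_adj] at h
    rw [Walk.length_cons]
    omega

/-- Every edge is a bridge: once it is deleted, no walk leaves the initial segment below it. -/
lemma girthAtLeast_pathGraph (n g : ℕ) : (pathGraph n).GirthAtLeast g := by
  have key : ∀ {a b c e : Fin n}, a.val + 1 = b.val →
      (pathGraph n \ edge a b).Walk c e → c ≤ a → e ≤ a := by
    intro a b c e hab p
    induction p with
    | nil => exact id
    | @cons c z e h p ih =>
      intro hc
      rw [sdiff_adj, pathGraph_adj, edge_adj] at h
      grind
  intro a b hab p
  rw [pathGraph_adj] at hab
  rcases hab with hab | hab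
  · have := key hab p le_rfl
    grind
  · rw [edge_comm] at p
    have := key hab p.reverse le_rfl
    grind

/-- A cycle on the first `g` vertices, with a path attached that visits all the others. -/
def lollipop (n g : ℕ) (hn : g < n) : SimpleGraph (Fin n) :=
  pathGraph n ⊔ edge ⟨0, by omega⟩ ⟨g - 1, by omega⟩

/-- The subgraph of `lollipop n g` on the first `g` vertices, with all other vertices isolated. -/
def lollipopCycle (n g : ℕ) (hn : g < n) : SimpleGraph (Fin n) where
  Adj u v := (lollipop n g hn).Adj u v ∧ u.val < g ∧ v.val < g
  symm := ⟨fun _ _ h => ⟨h.1.symm, h.2.2, h.2.1⟩⟩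
  loopless := ⟨fun _ h => h.1.ne rfl⟩

variable {n g : ℕ} (hn : g < n)

lemma lollipop_connected : (lollipop n g hn).Connected := by
  obtain ⟨n, rfl⟩ : ∃ m, n = m + 1 := ⟨n - 1, by omega⟩
  exact (pathGraph_connected n).mono le_sup_left

lemma girthAtLeast_lollipop : (lollipop n g hn).GirthAtLeast g :=
  (girthAtLeast_pathGraph n g).sup_edge fun p => by
    have := pathGraph_walk_le p
    simp only at this
    omega

lemma not_girthAtLeast_lollipopCycle (hg : 3 ≤ g) :
    ¬ (lollipopCycle n g hn).GirthAtLeast (g + 1) := by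
  intro h
  let a : Fin n := ⟨0, by omega⟩
  let b : Fin n := ⟨g - 1, by omega⟩
  have hab : a ≠ b := by
    rw [Ne, Fin.ext_iff]
    simp only [a, b]
    omega
  have hadj : (lollipopCycle n g hn).Adj a b := by
    refine ⟨.inr ((edge_adj _ _ _ _).2 ⟨.inl ⟨rfl, rfl⟩, hab⟩), ?_, ?_⟩ <;> simp only [a, b] <;> omega
  have walk : ∀ k (hk : k < g),
      ∃ p : ((lollipopCycle n g hn) \ edge a b).Walk a ⟨k, by omega⟩, p.length = k := by
    intro k
    induction k with
    | zero => exact fun _ => ⟨.nil, rfl⟩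
    | succ k ih =>
      intro hk
      obtain ⟨p, hp⟩ := ih (by omega)
      refine ⟨p.concat ⟨⟨.inl (by rw [pathGraph_adj]; simp), by simp only; omega, hk⟩, ?_⟩,
        by rw [Walk.length_concat, hp]⟩
      rw [edge_adj]
      simp only [a, b, Fin.ext_iff]
      omega
  obtain ⟨p, hp⟩ := walk (g - 1) (by omega)
  have := h hadj p
  omega

open Classical in
lemma degree_lollipop_le (hg : 3 ≤ g) (v : Fin n) :
    (lollipop n g hn).degree v ≤ if v.val = g - 1 then 3 else 2 := by
  have hpath : ∀ v : Fin n, (pathGraph n).degree v ≤ if v.val = 0 then 1 else 2 := by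
    intro v
    have hup : (Finset.univ.filter fun w : Fin n => v.val + 1 = w.val).card ≤ 1 := by
      rw [Finset.card_le_one]
      simp only [Finset.mem_filter, Finset.mem_univ, true_and, Fin.ext_iff]
      omega
    have hdown : (Finset.univ.filter fun w : Fin n => w.val + 1 = v.val).card ≤
        if v.val = 0 then 0 else 1 := by
      split_ifs with h
      · simp [h]
      · rw [Finset.card_le_one]
        simp only [Finset.mem_filter, Finset.mem_univ, true_and, Fin.ext_iff]
        omega
    rw [← card_neighborFinset_eq_degree, neighborFinset_eq_filter]
    simp only [pathGraph_adj]
    rw [Finset.filter_or]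
    refine (Finset.card_union_le _ _).trans ?_
    split_ifs at hdown ⊢ <;> omega
  have h := hpath v
  rw [degree_of_eq_sup_edge (H := lollipop n g hn) rfl (by rw [Ne, Fin.ext_iff]; simp only; omega)
    (by rw [pathGraph_adj]; simp only; omega)]
  simp only [Fin.ext_iff]
  split_ifs at h ⊢ <;> omega

end Lollipop


/-! ### Construction of the graph and the numerical bound. -/

open Classical in
/-- A balanced biregular graph on `2 * m` vertices exists as soon as `m` is even and large compared
with the Moore-type bound for the larger degree. -/
theorem exists_isBabiGraph {r s g m : ℕ} (hr : 2 ≤ r) (hrs : r < s) (hg : 3 ≤ g) (hm : Even m)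
    (hcard : 2 * (2 * ∑ t ∈ Finset.range (g - 1), (s - 1) ^ t + g) < m) :
    ∃ G : SimpleGraph (Fin (2 * m)), IsBabiGraph G r s g := by
  have hn : g < 2 * m := by omega
  have hlt : (Finset.univ.filter fun v : Fin (2 * m) => v.val < m).card = m := by
    rw [Fin.card_filter_val_lt]
    omega
  have hge : (Finset.univ.filter fun v : Fin (2 * m) => ¬ v.val < m).card = m := by
    have := Finset.card_filter_add_card_filter_not (s := Finset.univ)
      fun v : Fin (2 * m) => v.val < m
    rw [hlt, Finset.card_univ, Fintype.card_fin] at this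
    omega
  have hK : (Finset.univ.filter fun v : Fin (2 * m) => v.val < g).card = g := by
    rw [Fin.card_filter_val_lt]
    omega
  obtain ⟨G, hC, hconn, hgirth, hdeg⟩ := exists_degree_eq (s := s) (g := g) (by omega) hg
    (d := fun v : Fin (2 * m) => if v.val < m then s else r)
    (fun v => by split_ifs <;> omega)
    (by
      rw [Finset.sum_ite, Finset.sum_const, Finset.sum_const, hlt, hge, smul_eq_mul, smul_eq_mul,
        ← mul_add]
      exact hm.mul_right _)
    (C := lollipopCycle (2 * m) g hn) (fun _ _ h => h.1) (lollipop_connected hn)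
    (girthAtLeast_lollipop hn)
    -- The one vertex of degree possibly 3 is `g - 1 < m`, whose target is `s ≥ 3`.
    (fun v => by
      have h := degree_lollipop_le hn hg v
      have h' : (lollipop (2 * m) g hn).degree v ≤ if v.val = g - 1 then 3 else 2 := by
        convert! h
      refine h'.trans ?_
      split_ifs <;> omega)
    (K := Finset.univ.filter fun v => v.val < g) (T := Finset.univ.filter fun v => v.val < m)
    (fun a b h => by simpa using h.2.1) (fun v hv => if_pos (by simpa using hv))
    (by rwa [hK, hlt])
  have hs : ∀ v, G.degree v = s ↔ v.val < m := by
    intro v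
    rw [hdeg]
    split_ifs with h <;> simp only [h, iff_false]; omega
  have hr' : ∀ v, G.degree v = r ↔ ¬ v.val < m := by
    intro v
    rw [hdeg]
    split_ifs with h <;> simp only [h, not_true, not_false_iff, iff_false]; omega
  refine ⟨G, hconn, le_antisymm ?_ hgirth.le_egirth, ?_, ?_⟩
  · exact egirth_le_of_not_girthAtLeast fun h => not_girthAtLeast_lollipopCycle hn hg (h.anti hC)
  · ext k
    constructor
    · rintro ⟨v, rfl⟩
      by_cases h : v.val < m
      · exact .inr ((hs v).2 h)
      · exact .inl ((hr' v).2 h)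
    · rintro (rfl | rfl)
      · exact ⟨⟨m, by omega⟩, (hr' _).2 (lt_irrefl m)⟩
      · exact ⟨⟨0, by omega⟩, (hs _).2 (by simp only; omega)⟩
  · rw [Fintype.card_subtype, Fintype.card_subtype]
    simp only [hs, hr']
    rw [hlt, hge]

end SimpleGraph

theorem mainTheorem1 (r s g : ℕ) (hr : 2 ≤ r) (hrs : r < s) (hg : 3 ≤ g) :
    (∃ (n : ℕ) (G : SimpleGraph (Fin n)), IsBabiGraph G r s g) ∧
      nbb r s g ≤
        32 * (∑ t ∈ Finset.Icc 1 (g - 2), (r - 1) ^ t) *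
          (∑ t ∈ Finset.Icc 1 (g - 2), (s - 1) ^ t) := by
  set A := ∑ t ∈ Finset.Icc 1 (g - 2), (r - 1) ^ t
  set B := ∑ t ∈ Finset.Icc 1 (g - 2), (s - 1) ^ t with hB
  have hA : 1 ≤ A := by
    refine le_trans ?_ (Finset.single_le_sum (f := fun t => (r - 1) ^ t) (fun _ _ => Nat.zero_le _)
      (Finset.mem_Icc.2 ⟨le_rfl, by omega⟩ : 1 ∈ Finset.Icc 1 (g - 2)))
    simp only [pow_one]
    omega
  have hgB : (g - 2) * 2 ≤ B := by
    have := Finset.card_nsmul_le_sum (Finset.Icc 1 (g - 2)) (fun t => (s - 1) ^ t) 2 fun t ht =>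
      (show 2 ≤ s - 1 by omega).trans (Nat.le_self_pow (by rw [Finset.mem_Icc] at ht; omega) _)
    simpa using this
  have hrange : ∑ t ∈ Finset.range (g - 1), (s - 1) ^ t = B + 1 := by
    rw [show g - 1 = (g - 2) + 1 by omega, Finset.sum_range_succ', pow_zero, hB,
      Finset.range_eq_Ico, Finset.sum_Ico_add' (fun t => (s - 1) ^ t) 0 (g - 2) 1]
    rfl
  -- As `g ≤ B / 2 + 2` and `B ≥ 2`, the requirement `4(B + 1) + 2g < 16B` holds; the `+ 1` is the
  -- term `t = 0`.
  obtain ⟨G, hG⟩ := SimpleGraph.exists_isBabiGraph (m := 16 * B) hr hrs hg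
    (Even.mul_right (by decide) B) (by rw [hrange]; omega)
  refine ⟨⟨_, G, hG⟩, (Nat.sInf_le (show 2 * (16 * B) ∈ babiOrders r s g from ⟨G, hG⟩)).trans ?_⟩
  calc 2 * (16 * B) = 32 * 1 * B := by ring
    _ ≤ 32 * A * B := by gcongr
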